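/- Let $n\ge 1$ and let $X_1,\dots,X_n$ be negatively associated (NA) real random variables: for all disjoint $A_1,A_2\subseteq\{1,\dots,n\}$ and all coordinatewise nondecreasing (Borel) functions $f_1,f_2$, $\operatorname{Cov}\big(f_1(X_i,i\in A_1),f_2(X_j,j\in A_2)\big)\le 0$ whenever this covariance exists. Suppose $\mathbb E X_i=0$ and that there are real constants $m_i,M_i$ with $m_i\le X_i\le M_i$ almost surely, $1\le i\le n$. Put $S_k=\sum_{i=1}^k X_i$, $$M^2(n)=\sum_{i=1}^n (M_i-m_i)^2,\qquad D(n)=\sum_{i=1}^n (M_i-m_i),$$ and assume $D(n)>0$. Let $$\ell(t)=(t-\ln t-1)+\frac{t}{e^t-1}+\ln(1-e^{-t})\quad(t>0),\qquad \ell(0)=0,\qquad \ell^*(x)=\sup_{t>0}\,(xt-\ell(t))\in[0,+\infty]\quad (0\le x\le 1),$$ with the convention $e^{-\infty}=0$. Then: (i) for every $t\ge 0$, $e^{tS_n}$ is integrable and $$\mathbb E\, e^{tS_n}\le \exp\Big\{\frac{D^2(n)}{M^2(n)}\,\ell\Big(\frac{M^2(n)}{D(n)}\,t\Big)\Big\};$$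 (ii) for every $0<\alpha<1$ and every $0\le x\le D(n)$, $$\mathbb P\Big(\max_{1\le k\le n}S_k\ge x\Big)\le (1-\alpha)^{-1}\exp\Big\{-\frac{\alpha D^2(n)}{M^2(n)}\,\ell^*\Big(\frac{x}{D(n)}\Big)\Big\}$$ and, consequently, $$\mathbb P\Big(\max_{1\le k\le n}S_k\ge x\Big)\le (1-\alpha)^{-1}\Big(\frac{D(n)-x}{D(n)}\Big)^{\frac{2D(n)-x}{M^2(n)}\,\alpha x},$$ where the last power improves on the Hoeffding–Azuma exponential: $$\Big(\frac{D(n)-x}{D(n)}\Big)^{\frac{2D(n)-x}{M^2(n)}\,\alpha x}\le \exp\Big\{-\frac{2\alpha x^2}{M^2(n)}\Big\};$$ (iii) in particular, for every $0\le x\le D(n)$, $$\mathbb P\Big(\max_{1\le k\le n}S_k\ge x\Big)\le 2\exp\Big\{-\frac{D^2(n)}{2M^2(n)}\,\ell^*\Big(\frac{x}{D(n)}\Big)\Big\}\le 2\Big(\frac{D(n)-x}{D(n)}\Big)^{\frac{2D(n)-x}{2M^2(n)}\,x}.$$ -/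

import Mathlib

open MeasureTheory ProbabilityTheory

/-- The random variables `X i`, `i ∈ s`, are negatively associated under `μ`: for any two disjoint
sets of indices `A₁, A₂ ⊆ s` and any coordinatewise nondecreasing Borel functions `f₁, f₂`, one has
`Cov (f₁ (X i, i ∈ A₁), f₂ (X j, j ∈ A₂)) ≤ 0` whenever this covariance exists, that is, whenever
both variables and their product are integrable. -/
def NegativelyAssociated {Ω : Type*} [MeasurableSpace Ω] {ι : Type*}
    (X : ι → Ω → ℝ) (s : Finset ι) (μ : Measure Ω) : Prop :=
  ∀ A₁ A₂ : Finset ι, A₁ ⊆ s → A₂ ⊆ s → Disjoint A₁ A₂ →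
    ∀ (f₁ : (A₁ → ℝ) → ℝ) (f₂ : (A₂ → ℝ) → ℝ),
      Monotone f₁ → Monotone f₂ → Measurable f₁ → Measurable f₂ →
      Integrable (fun ω => f₁ fun i => X i ω) μ →
      Integrable (fun ω => f₂ fun j => X j ω) μ →
      Integrable (fun ω => (f₁ fun i => X i ω) * (f₂ fun j => X j ω)) μ →
      covariance (fun ω => f₁ fun i => X i ω) (fun ω => f₂ fun j => X j ω) μ ≤ 0

/-- The partial sum `S_k = X_1 + ⋯ + X_k`. -/
def partialSum {Ω : Type*} (X : ℕ → Ω → ℝ) (k : ℕ) (ω : Ω) : ℝ :=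
  ∑ i ∈ Finset.Icc 1 k, X i ω

/-- `max_{1 ≤ k ≤ n} S_k`, for `n ≥ 1`. -/
noncomputable def maxPartialSum {Ω : Type*} (X : ℕ → Ω → ℝ) (n : ℕ) (hn : 1 ≤ n) (ω : Ω) : ℝ :=
  (Finset.Icc 1 n).sup' (Finset.nonempty_Icc.mpr hn) fun k => partialSum X k ω

/-- Rio's function `ℓ(t) = (t - ln t - 1) + t (e^t - 1)⁻¹ + ln (1 - e^{-t})` for `t > 0`, extended
continuously by `ℓ(0) = 0`. Only arguments `t ≥ 0` matter. -/
noncomputable def rioEll (t : ℝ) : ℝ :=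
  if t = 0 then 0
  else (t - Real.log t - 1) + t * (Real.exp t - 1)⁻¹ + Real.log (1 - Real.exp (-t))

/-- The Young transform `ℓ*(x) = sup_{t > 0} (x t - ℓ(t))`. It is extended-real-valued:
the supremum is `+∞` at `x = 1`. -/
noncomputable def rioEllStar (x : ℝ) : EReal :=
  ⨆ t : {t : ℝ // 0 < t}, ((x * t.1 - rioEll t.1 : ℝ) : EReal)

/-- `D(n) = ∑_{i ≤ n} (M_i - m_i)`. -/
def rangeSum (m M : ℕ → ℝ) (n : ℕ) : ℝ := ∑ i ∈ Finset.Icc 1 n, (M i - m i)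

/-- `M²(n) = ∑_{i ≤ n} (M_i - m_i)²`. -/
def rangeSqSum (m M : ℕ → ℝ) (n : ℕ) : ℝ := ∑ i ∈ Finset.Icc 1 n, (M i - m i) ^ 2

/-!
The exponential moment bound and the maximal inequality rest on three facts.

*One variable.* A centred variable with values in `[m, M]` satisfies `E e^{tX} ≤ e^{ℓ((M - m) t)}`
(`mgf_le_exp_rioEll`): by convexity only two-point laws matter, and `ℓ` is the supremum of their
log-Laplace transforms. Negative association bounds the exponential moment of the sum by the product
(`NegativelyAssociated.mgf_sum_le`), and `∑ ℓ(Δ_i t) ≤ (D² / M²) ℓ(M² t / D)` is Jensen's inequality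
for `ℓ(t) / t` (`sum_rioEll_le`). The concavity of this function follows from
`ℓ(2s) = (s log (sinh s / s))'` and from the concavity of the Langevin function `coth s - 1 / s`.

*The maximum.* Let `T` be the maximum of `0` and the partial sums. Splitting off the first variable
writes `T = max 0 (X₁ + T')` with `T'` a nondecreasing function of the other variables. Negative
association therefore implies that `E (X₁ + T' - u)⁺` can only grow when `X₁` and `T'` are made
independent (`lintegral_ofReal_add_sub_le`), and induction gives `E (T - u)⁺ ≤ A e^{-tu} / t` with
`A = ∏ E e^{t X_i}` (`lintegral_reflectedWalk_sub_le`). Markov's inequality at `u = x - 1 / t` yields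
`P(T ≥ x) ≤ e A e^{-tx}`; since a probability is also at most `1`, this implies the bound
`(1 - α)⁻¹ (A e^{-tx})^α` (`min_one_exp_one_mul_le`), and one optimizes over `t`.

*The Young transform.* The explicit bounds need `ℓ*(y) ≥ (y² - 2y) log (1 - y)` (`le_rioEllStar`).
It is enough to exhibit one `t` for each `y`: `t = 4y` for `y ≤ 1/2`, where a Taylor bound for `ℓ`
comes from the Riccati equation of the Langevin function, and `t = 1 / (1 - y)` for `y ≥ 1/2`, where
`ℓ(t)` differs from `t - log t - 1` by an exponentially small amount. At `y = 1`, `ℓ*` is infinite.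
-/

section

open Set Filter Topology

/-! ### The Langevin function and its primitive -/

/-- A function on `(0, b)` with nonnegative derivative and limit `0` at `0⁺` is nonnegative. The
limit replaces the value at `0`, where the quotients below only have junk values. -/
theorem nonneg_of_hasDerivAt_nonneg_of_tendsto_zero {f f' : ℝ → ℝ} {b : ℝ}
    (hf : ∀ x ∈ Ioo 0 b, HasDerivAt f (f' x) x) (hf' : ∀ x ∈ Ioo 0 b, 0 ≤ f' x)
    (h0 : Tendsto f (𝓝[>] 0) (𝓝 0)) {x : ℝ} (hx : x ∈ Ioo 0 b) : 0 ≤ f x := by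
  have hmono : MonotoneOn f (Ioo 0 b) := by
    refine monotoneOn_of_deriv_nonneg (convex_Ioo 0 b)
      (fun y hy => (hf y hy).continuousAt.continuousWithinAt) ?_ ?_
    · intro y hy
      rw [interior_Ioo] at hy
      exact (hf y hy).differentiableAt.differentiableWithinAt
    · intro y hy
      rw [interior_Ioo] at hy
      rw [(hf y hy).deriv]
      exact hf' y hy
  refine le_of_tendsto h0 ?_
  filter_upwards [Ioo_mem_nhdsGT hx.1] with y hy
  exact hmono ⟨hy.1, hy.2.trans hx.2⟩ hx hy.2.le

/-- The Langevin function `coth s - 1 / s`. Only arguments `s > 0` matter. -/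
noncomputable def langevin (s : ℝ) : ℝ := Real.cosh s / Real.sinh s - 1 / s

/-- The primitive `log (sinh s / s)` of the Langevin function that vanishes at `0⁺`. -/
noncomputable def logSinhc (s : ℝ) : ℝ := Real.log (Real.sinh s / s)

/-- In the variable `s = t / 2`, Rio's function is the derivative of `s ↦ s * logSinhc s`. -/
theorem rioEll_two_mul {s : ℝ} (hs : 0 < s) :
    rioEll (2 * s) = logSinhc s + s * langevin s := by
  have h1 : 0 < Real.sinh s := Real.sinh_pos_iff.2 hs
  have e1 : Real.exp (2 * s) - 1 = 2 * Real.exp s * Real.sinh s := by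
    rw [Real.sinh_eq, two_mul, Real.exp_add, Real.exp_neg]
    field_simp
  have e2 : 1 - Real.exp (-(2 * s)) = 2 * Real.exp (-s) * Real.sinh s := by
    rw [Real.sinh_eq, two_mul, neg_add, Real.exp_add, Real.exp_neg]
    field_simp
  have e3 : Real.exp (-s) = Real.cosh s - Real.sinh s := (Real.cosh_sub_sinh s).symm
  have e4 : (2 * s) * (Real.exp (2 * s) - 1)⁻¹ = s * (Real.cosh s / Real.sinh s) - s := by
    rw [e1, mul_inv, mul_inv, ← Real.exp_neg, e3]
    field_simp
  unfold rioEll logSinhc langevin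
  rw [if_neg (by positivity), e4, e2, Real.log_div h1.ne' hs.ne', Real.log_mul (by positivity) h1.ne',
    Real.log_mul two_ne_zero (Real.exp_pos _).ne', Real.log_exp, Real.log_mul two_ne_zero hs.ne']
  field_simp
  ring

theorem hasDerivAt_logSinhc {s : ℝ} (hs : 0 < s) : HasDerivAt logSinhc (langevin s) s := by
  have h1 : 0 < Real.sinh s := Real.sinh_pos_iff.2 hs
  have := ((Real.hasDerivAt_sinh s).div (hasDerivAt_id s) hs.ne').log
    (div_pos h1 hs).ne'
  refine this.congr_deriv ?_
  unfold langevin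
  simp only [Pi.div_apply, id]
  field_simp

theorem hasDerivAt_langevin {s : ℝ} (hs : 0 < s) :
    HasDerivAt langevin (1 / s ^ 2 - 1 / Real.sinh s ^ 2) s := by
  have h1 : 0 < Real.sinh s := Real.sinh_pos_iff.2 hs
  have := ((Real.hasDerivAt_cosh s).div (Real.hasDerivAt_sinh s) h1.ne').sub
    ((hasDerivAt_const s (1 : ℝ)).div (hasDerivAt_id s) hs.ne')
  refine this.congr_deriv ?_
  have h2 := Real.cosh_sq s
  simp only [id]
  field_simp
  rw [h2]
  ring

/-- The Riccati equation `c' = 1 - c² - 2 c / s` of the Langevin function `c`, in integrated form.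
Substituting bounds for `c` on the right-hand side produces sharper bounds of the opposite
direction. -/
theorem hasDerivAt_sq_mul_langevin {s : ℝ} (hs : 0 < s) :
    HasDerivAt (fun s => s ^ 2 * langevin s) (s ^ 2 * (1 - langevin s ^ 2)) s := by
  have h1 : 0 < Real.sinh s := Real.sinh_pos_iff.2 hs
  have := (hasDerivAt_pow 2 s).mul (hasDerivAt_langevin hs)
  refine this.congr_deriv ?_
  have h2 := Real.cosh_sq s
  unfold langevin
  norm_num
  field_simp
  linear_combination s ^ 2 * h2


theorem tendsto_sinh_div_self : Tendsto (fun s : ℝ => Real.sinh s / s) (𝓝[>] 0) (𝓝 1) := by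
  have := (Real.hasDerivAt_sinh 0).tendsto_slope
  rw [Real.cosh_zero] at this
  refine (this.mono_left (nhdsWithin_mono _ fun x hx => ne_of_gt hx)).congr fun s => ?_
  simp [slope_def_field]

theorem tendsto_logSinhc : Tendsto logSinhc (𝓝[>] 0) (𝓝 0) := by
  have := tendsto_sinh_div_self.log one_ne_zero
  rwa [Real.log_one] at this

theorem tendsto_self_mul_langevin : Tendsto (fun s => s * langevin s) (𝓝[>] 0) (𝓝 0) := by
  have h1 := tendsto_sinh_div_self.inv₀ one_ne_zero
  have h2 : Tendsto Real.cosh (𝓝[>] 0) (𝓝 (Real.cosh 0)) :=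
    Real.continuous_cosh.continuousAt.tendsto.mono_left nhdsWithin_le_nhds
  have h3 := (h2.mul h1).sub_const 1
  simp only [Real.cosh_zero, inv_one, mul_one, sub_self] at h3
  refine h3.congr' ?_
  filter_upwards [self_mem_nhdsWithin] with s hs
  have hs : 0 < s := hs
  have h1 : 0 < Real.sinh s := Real.sinh_pos_iff.2 hs
  unfold langevin
  field_simp

theorem tendsto_pow_nhdsGT_zero {k : ℕ} (hk : k ≠ 0) (c : ℝ) :
    Tendsto (fun s : ℝ => c * s ^ k) (𝓝[>] 0) (𝓝 0) := by
  have : Continuous fun s : ℝ => c * s ^ k := by fun_prop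
  have := this.tendsto 0
  simp only [ne_eq, hk, not_false_eq_true, zero_pow, mul_zero] at this
  exact this.mono_left nhdsWithin_le_nhds

theorem tendsto_sq_mul_langevin : Tendsto (fun s => s ^ 2 * langevin s) (𝓝[>] 0) (𝓝 0) := by
  have := (tendsto_pow_nhdsGT_zero one_ne_zero 1).mul tendsto_self_mul_langevin
  rw [mul_zero] at this
  refine this.congr fun s => ?_
  ring

theorem langevin_nonneg {s : ℝ} (hs : 0 < s) : 0 ≤ langevin s := by
  have h1 : 0 < Real.sinh s := Real.sinh_pos_iff.2 hs
  have key : 0 ≤ s * Real.cosh s - Real.sinh s := by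
    refine nonneg_of_hasDerivAt_nonneg_of_tendsto_zero (b := s + 1)
      (f := fun x => x * Real.cosh x - Real.sinh x) (f' := fun x => x * Real.sinh x) ?_ ?_ ?_
      ⟨hs, by linarith⟩
    · intro x _
      have := ((hasDerivAt_id x).mul (Real.hasDerivAt_cosh x)).sub (Real.hasDerivAt_sinh x)
      refine this.congr_deriv ?_
      simp
    · intro x hx
      exact mul_nonneg hx.1.le (Real.sinh_nonneg_iff.2 hx.1.le)
    · have : Continuous fun x : ℝ => x * Real.cosh x - Real.sinh x := by fun_prop
      have := this.tendsto 0
      simp only [zero_mul, Real.sinh_zero, sub_zero] at this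
      exact this.mono_left nhdsWithin_le_nhds
  have : langevin s = (s * Real.cosh s - Real.sinh s) / (s * Real.sinh s) := by
    unfold langevin; field_simp
  rw [this]
  positivity

theorem langevin_le_div_three {s : ℝ} (hs : 0 < s) : langevin s ≤ s / 3 := by
  have key : 0 ≤ 1 / 3 * s ^ 3 - s ^ 2 * langevin s := by
    refine nonneg_of_hasDerivAt_nonneg_of_tendsto_zero (b := s + 1)
      (f := fun x => 1 / 3 * x ^ 3 - x ^ 2 * langevin x) (f' := fun x => x ^ 2 * langevin x ^ 2)
      ?_ ?_ ?_ ⟨hs, by linarith⟩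
    · intro x hx
      refine (((hasDerivAt_pow 3 x).const_mul (1 / 3)).sub
        (hasDerivAt_sq_mul_langevin hx.1)).congr_deriv ?_
      norm_num
      ring
    · intro x hx
      positivity
    · simpa using (tendsto_pow_nhdsGT_zero (k := 3) (by norm_num) (1 / 3)).sub
        tendsto_sq_mul_langevin
  have : 0 ≤ s ^ 2 * (s / 3 - langevin s) := by nlinarith
  have := nonneg_of_mul_nonneg_right this (by positivity)
  linarith

theorem langevin_ge {s : ℝ} (hs : 0 < s) : s / 3 - s ^ 3 / 45 ≤ langevin s := by
  have key : 0 ≤ s ^ 2 * langevin s - 1 / 3 * s ^ 3 + 1 / 45 * s ^ 5 := by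
    refine nonneg_of_hasDerivAt_nonneg_of_tendsto_zero (b := s + 1)
      (f := fun x => x ^ 2 * langevin x - 1 / 3 * x ^ 3 + 1 / 45 * x ^ 5)
      (f' := fun x => x ^ 2 * ((x / 3) ^ 2 - langevin x ^ 2))
      ?_ ?_ ?_ ⟨hs, by linarith⟩
    · intro x hx
      refine (((hasDerivAt_sq_mul_langevin hx.1).sub
        ((hasDerivAt_pow 3 x).const_mul (1 / 3))).add
        ((hasDerivAt_pow 5 x).const_mul (1 / 45))).congr_deriv ?_
      norm_num
      ring
    · intro x hx
      have := pow_le_pow_left₀ (langevin_nonneg hx.1) (langevin_le_div_three hx.1) 2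
      exact mul_nonneg (by positivity) (by linarith)
    · simpa using (tendsto_sq_mul_langevin.sub (tendsto_pow_nhdsGT_zero (k := 3) (by norm_num)
        (1 / 3))).add (tendsto_pow_nhdsGT_zero (k := 5) (by norm_num) (1 / 45))
  have : 0 ≤ s ^ 2 * (langevin s - (s / 3 - s ^ 3 / 45)) := by nlinarith
  have := nonneg_of_mul_nonneg_right this (by positivity)
  linarith

theorem langevin_le {s : ℝ} (hs : 0 < s) (hs2 : s < 2) :
    langevin s ≤ s / 3 - s ^ 3 / 45 + 2 * s ^ 5 / 945 := by
  have key : 0 ≤ 1 / 3 * s ^ 3 - 1 / 45 * s ^ 5 + 2 / 945 * s ^ 7 - s ^ 2 * langevin s := by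
    refine nonneg_of_hasDerivAt_nonneg_of_tendsto_zero (b := 2)
      (f := fun x => 1 / 3 * x ^ 3 - 1 / 45 * x ^ 5 + 2 / 945 * x ^ 7 - x ^ 2 * langevin x)
      (f' := fun x => x ^ 2 * (langevin x ^ 2 - (x / 3) ^ 2 + 2 / 135 * x ^ 4))
      ?_ ?_ ?_ ⟨hs, hs2⟩
    · intro x hx
      refine (((((hasDerivAt_pow 3 x).const_mul (1 / 3)).sub
        ((hasDerivAt_pow 5 x).const_mul (1 / 45))).add
        ((hasDerivAt_pow 7 x).const_mul (2 / 945))).sub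
        (hasDerivAt_sq_mul_langevin hx.1)).congr_deriv ?_
      norm_num
      ring
    · intro x hx
      obtain ⟨hx0, hx2⟩ := hx
      have h0 : 0 ≤ x / 3 - x ^ 3 / 45 := by
        have : x / 3 - x ^ 3 / 45 = x * (15 - x ^ 2) / 45 := by ring
        rw [this]
        have : 0 ≤ 15 - x ^ 2 := by nlinarith
        positivity
      have := pow_le_pow_left₀ h0 (langevin_ge hx0) 2
      refine mul_nonneg (by positivity) ?_
      have h6 : 0 ≤ x ^ 6 := by positivity
      nlinarith
    · simpa using (((tendsto_pow_nhdsGT_zero (k := 3) (by norm_num) (1 / 3)).sub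
        (tendsto_pow_nhdsGT_zero (k := 5) (by norm_num) (1 / 45))).add
        (tendsto_pow_nhdsGT_zero (k := 7) (by norm_num) (2 / 945))).sub tendsto_sq_mul_langevin
  have : 0 ≤ s ^ 2 * (s / 3 - s ^ 3 / 45 + 2 * s ^ 5 / 945 - langevin s) := by nlinarith
  have := nonneg_of_mul_nonneg_right this (by positivity)
  linarith

theorem logSinhc_le {s : ℝ} (hs : 0 < s) (hs2 : s < 2) :
    logSinhc s ≤ s ^ 2 / 6 - s ^ 4 / 180 + s ^ 6 / 2835 := by
  have key : 0 ≤ 1 / 6 * s ^ 2 - 1 / 180 * s ^ 4 + 1 / 2835 * s ^ 6 - logSinhc s := by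
    refine nonneg_of_hasDerivAt_nonneg_of_tendsto_zero (b := 2)
      (f := fun x => 1 / 6 * x ^ 2 - 1 / 180 * x ^ 4 + 1 / 2835 * x ^ 6 - logSinhc x)
      (f' := fun x => x / 3 - x ^ 3 / 45 + 2 * x ^ 5 / 945 - langevin x) ?_ ?_ ?_ ⟨hs, hs2⟩
    · intro x hx
      refine (((((hasDerivAt_pow 2 x).const_mul (1 / 6)).sub
        ((hasDerivAt_pow 4 x).const_mul (1 / 180))).add
        ((hasDerivAt_pow 6 x).const_mul (1 / 2835))).sub
        (hasDerivAt_logSinhc hx.1)).congr_deriv ?_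
      norm_num
      ring
    · intro x hx
      linarith [langevin_le hx.1 hx.2]
    · simpa using (((tendsto_pow_nhdsGT_zero (k := 2) (by norm_num) (1 / 6)).sub
        (tendsto_pow_nhdsGT_zero (k := 4) (by norm_num) (1 / 180))).add
        (tendsto_pow_nhdsGT_zero (k := 6) (by norm_num) (1 / 2835))).sub tendsto_logSinhc
  linarith

theorem rioEll_two_mul_le {s : ℝ} (hs : 0 < s) (hs2 : s < 2) :
    rioEll (2 * s) ≤ s ^ 2 / 2 - s ^ 4 / 36 + s ^ 6 / 405 := by
  rw [rioEll_two_mul hs]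
  have := logSinhc_le hs hs2
  have := mul_le_mul_of_nonneg_left (langevin_le hs hs2) hs.le
  nlinarith

/-! ### Concavity of `ℓ(t) / t` -/

/-- The Mitrinović–Adamović inequality `cosh s ≤ (sinh s / s)³`. It amounts to the concavity of the
Langevin function on `(0, ∞)`. -/
theorem cube_mul_cosh_le_sinh_cube {s : ℝ} (hs : 0 < s) :
    s ^ 3 * Real.cosh s ≤ Real.sinh s ^ 3 := by
  have key : 0 ≤ Real.sinh s * Real.cosh s ^ (-1 / 3 : ℝ) - s := by
    refine nonneg_of_hasDerivAt_nonneg_of_tendsto_zero (b := s + 1)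
      (f := fun x => Real.sinh x * Real.cosh x ^ (-1 / 3 : ℝ) - x)
      (f' := fun x => Real.cosh x * Real.cosh x ^ (-1 / 3 : ℝ) + Real.sinh x *
        (Real.sinh x * (-1 / 3) * Real.cosh x ^ ((-1 / 3 : ℝ) - 1)) - 1) ?_ ?_ ?_
      ⟨hs, by linarith⟩
    · intro x _
      exact ((Real.hasDerivAt_sinh x).mul ((Real.hasDerivAt_cosh x).rpow_const
        (Or.inl (Real.cosh_pos x).ne'))).sub (hasDerivAt_id x)
    · intro x _
      have hc := Real.cosh_pos x
      set d := Real.cosh x ^ (-1 / 3 : ℝ) with hd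
      have hd0 : 0 < d := by positivity
      have hd3 : d ^ 3 * Real.cosh x = 1 := by
        rw [hd, ← Real.rpow_natCast, ← Real.rpow_mul hc.le]
        norm_num
        rw [Real.rpow_neg_one]
        field_simp
      have h1 : Real.cosh x ^ ((-1 / 3 : ℝ) - 1) = d / Real.cosh x := by
        rw [Real.rpow_sub_one hc.ne']
      rw [h1]
      have h2 := Real.cosh_sq x
      have hcd : Real.cosh x = 1 / d ^ 3 := by field_simp; linarith
      have h3 : Real.sinh x * (Real.sinh x * (-1 / 3) * (d / Real.cosh x))
          = -1 / 3 * (Real.cosh x ^ 2 - 1) * (d / Real.cosh x) := by rw [h2]; ring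
      rw [h3, hcd]
      -- with `d = cosh x ^ (-1/3)`, nonnegativity of the derivative is an instance of AM-GM
      have h4 : 1 / d ^ 3 * d + -1 / 3 * ((1 / d ^ 3) ^ 2 - 1) * (d / (1 / d ^ 3)) - 1
          = (d ^ 2 - 1) ^ 2 * (d ^ 2 + 2) / (3 * d ^ 2) := by
        field_simp
        ring
      rw [h4]
      positivity
    · have : Continuous fun x : ℝ => Real.sinh x * Real.cosh x ^ (-1 / 3 : ℝ) - x :=
        (Real.continuous_sinh.mul (Real.continuous_cosh.rpow_const
          fun x => Or.inl (Real.cosh_pos x).ne')).sub continuous_id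
      have := this.tendsto 0
      simp only [Real.sinh_zero, zero_mul, sub_zero] at this
      exact this.mono_left nhdsWithin_le_nhds
  have hc := Real.cosh_pos s
  have h := pow_le_pow_left₀ hs.le (sub_nonneg.1 key) 3
  have hd3 : (Real.cosh s ^ (-1 / 3 : ℝ)) ^ 3 * Real.cosh s = 1 := by
    rw [← Real.rpow_natCast, ← Real.rpow_mul hc.le]
    norm_num
    rw [Real.rpow_neg_one]
    field_simp
  calc s ^ 3 * Real.cosh s ≤ (Real.sinh s * Real.cosh s ^ (-1 / 3 : ℝ)) ^ 3 * Real.cosh s := by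
        gcongr
    _ = Real.sinh s ^ 3 * ((Real.cosh s ^ (-1 / 3 : ℝ)) ^ 3 * Real.cosh s) := by ring
    _ = Real.sinh s ^ 3 := by rw [hd3, mul_one]

theorem hasDerivAt_deriv_langevin {s : ℝ} (hs : 0 < s) :
    HasDerivAt (fun s => 1 / s ^ 2 - 1 / Real.sinh s ^ 2)
      (2 * Real.cosh s / Real.sinh s ^ 3 - 2 / s ^ 3) s := by
  have h1 : 0 < Real.sinh s := Real.sinh_pos_iff.2 hs
  have := ((hasDerivAt_const s (1 : ℝ)).div (hasDerivAt_pow 2 s) (by positivity)).sub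
    ((hasDerivAt_const s (1 : ℝ)).div ((Real.hasDerivAt_sinh s).pow 2)
      (pow_ne_zero 2 h1.ne'))
  refine this.congr_deriv ?_
  norm_num
  field_simp
  ring

theorem deriv2_langevin_nonpos {s : ℝ} (hs : 0 < s) :
    2 * Real.cosh s / Real.sinh s ^ 3 - 2 / s ^ 3 ≤ 0 := by
  have h1 : 0 < Real.sinh s := Real.sinh_pos_iff.2 hs
  rw [sub_nonpos, div_le_div_iff₀ (by positivity) (by positivity)]
  linarith [cube_mul_cosh_le_sinh_cube hs]

/-- The left-hand side is `s³` times the second derivative of `logSinhc s / s`. Its own derivative is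
`s²` times the second derivative of the Langevin function. -/
theorem logSinhc_div_deriv2_numerator_nonpos {s : ℝ} (hs : 0 < s) :
    s ^ 2 * (1 / s ^ 2 - 1 / Real.sinh s ^ 2) - 2 * (s * langevin s) + 2 * logSinhc s ≤ 0 := by
  have key : 0 ≤ -(s ^ 2 * (1 / s ^ 2 - 1 / Real.sinh s ^ 2)) + 2 * (s * langevin s)
      - 2 * logSinhc s := by
    refine nonneg_of_hasDerivAt_nonneg_of_tendsto_zero (b := s + 1)
      (f := fun s => -(s ^ 2 * (1 / s ^ 2 - 1 / Real.sinh s ^ 2)) + 2 * (s * langevin s)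
      - 2 * logSinhc s)
      (f' := fun s => -(s ^ 2 * (2 * Real.cosh s / Real.sinh s ^ 3 - 2 / s ^ 3)))
      ?_ ?_ ?_ ⟨hs, by linarith⟩
    · intro x hx
      have := (((hasDerivAt_pow 2 x).mul (hasDerivAt_deriv_langevin hx.1)).neg.add
        (((hasDerivAt_id x).mul (hasDerivAt_langevin hx.1)).const_mul 2)).sub
        ((hasDerivAt_logSinhc hx.1).const_mul 2)
      refine this.congr_deriv ?_
      norm_num
      ring
    · intro x hx
      have := mul_nonneg (sq_nonneg x) (neg_nonneg.2 (deriv2_langevin_nonpos hx.1))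
      linarith
    · have h1 := (tendsto_sinh_div_self.inv₀ one_ne_zero).pow 2
      have h2 := (((h1.sub_const 1).add (tendsto_self_mul_langevin.const_mul 2))).sub
        (tendsto_logSinhc.const_mul 2)
      norm_num at h2
      refine h2.congr' ?_
      filter_upwards [self_mem_nhdsWithin] with x hx
      have hx : 0 < x := hx
      have h1 : 0 < Real.sinh x := Real.sinh_pos_iff.2 hx
      field_simp
      ring
  linarith

/-- Up to a factor `2`, this function is `ℓ(t) / t` at `t = 2 s`. -/
theorem concaveOn_logSinhc_div_add_langevin :
    ConcaveOn ℝ (Ioi 0) fun s => logSinhc s / s + langevin s := by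
  have hd : ∀ x ∈ Ioi (0 : ℝ), HasDerivAt (fun s => logSinhc s / s + langevin s)
      ((langevin x * x - logSinhc x) / x ^ 2 + (1 / x ^ 2 - 1 / Real.sinh x ^ 2)) x := by
    intro x hx
    have hx : 0 < x := hx
    have := ((hasDerivAt_logSinhc hx).div (hasDerivAt_id x) hx.ne').add (hasDerivAt_langevin hx)
    refine this.congr_deriv ?_
    simp
  refine concaveOn_of_hasDerivWithinAt2_nonpos (convex_Ioi 0)
    (fun x hx => (hd x hx).continuousAt.continuousWithinAt)
    (f' := fun x => (langevin x * x - logSinhc x) / x ^ 2 + (1 / x ^ 2 - 1 / Real.sinh x ^ 2))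
    (f'' := fun x => (x ^ 2 * (1 / x ^ 2 - 1 / Real.sinh x ^ 2) - 2 * (x * langevin x)
      + 2 * logSinhc x) / x ^ 3 + (2 * Real.cosh x / Real.sinh x ^ 3 - 2 / x ^ 3)) ?_ ?_ ?_
  · intro x hx
    rw [interior_Ioi] at hx
    exact (hd x hx).hasDerivWithinAt
  · intro x hx
    rw [interior_Ioi] at hx
    have hx : 0 < x := hx
    have h1 : 0 < Real.sinh x := Real.sinh_pos_iff.2 hx
    have := (((((hasDerivAt_langevin hx).mul (hasDerivAt_id x)).sub (hasDerivAt_logSinhc hx)).div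
      (hasDerivAt_pow 2 x) (by positivity)).add (hasDerivAt_deriv_langevin hx))
    refine (this.congr_deriv ?_).hasDerivWithinAt
    norm_num
    field_simp
    ring
  · intro x hx
    rw [interior_Ioi] at hx
    have hx : 0 < x := hx
    have := div_nonpos_of_nonpos_of_nonneg (logSinhc_div_deriv2_numerator_nonpos hx)
      (pow_pos hx 3).le
    have := deriv2_langevin_nonpos hx
    linarith

/-- Jensen's inequality for the concave function `ℓ(t) / t`, with weights `d i / ∑ d` at the points
`d i * t`. -/
theorem sum_rioEll_le {ι : Type*} (s : Finset ι) (d : ι → ℝ) (hd : ∀ i ∈ s, 0 ≤ d i)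
    (hpos : 0 < ∑ i ∈ s, d i) {t : ℝ} (ht : 0 ≤ t) :
    ∑ i ∈ s, rioEll (d i * t) ≤ (∑ i ∈ s, d i) ^ 2 / (∑ i ∈ s, d i ^ 2) *
      rioEll ((∑ i ∈ s, d i ^ 2) / (∑ i ∈ s, d i) * t) := by
  rcases ht.eq_or_lt with rfl | ht
  · simp [rioEll]
  set D := ∑ i ∈ s, d i with hD
  have hM : 0 < ∑ i ∈ s, d i ^ 2 := by
    obtain ⟨i, hi, h⟩ := Finset.exists_lt_of_sum_lt (s := s) (f := fun _ => (0 : ℝ)) (g := d)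
      (by simpa using hpos)
    exact Finset.sum_pos' (fun _ _ => sq_nonneg _) ⟨i, hi, by positivity⟩
  -- terms with `d i = 0` contribute nothing on either side
  set s' := s.filter fun i => d i ≠ 0 with hs'
  have hsub : s' ⊆ s := Finset.filter_subset _ _
  have hz : ∀ i ∈ s, i ∉ s' → d i = 0 := fun i hi hn => by
    by_contra h; exact hn (Finset.mem_filter.2 ⟨hi, h⟩)
  have hpos' : ∀ i ∈ s', 0 < d i := fun i hi =>
    lt_of_le_of_ne (hd i (hsub hi)) (Finset.mem_filter.1 hi).2.symm
  have e1 : ∑ i ∈ s', d i = D := Finset.sum_subset hsub hz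
  have e2 : ∑ i ∈ s', d i ^ 2 = ∑ i ∈ s, d i ^ 2 :=
    Finset.sum_subset hsub fun i hi hn => by simp [hz i hi hn]
  have e3 : ∑ i ∈ s', rioEll (d i * t) = ∑ i ∈ s, rioEll (d i * t) :=
    Finset.sum_subset hsub fun i hi hn => by simp [hz i hi hn, rioEll]
  have hJ := concaveOn_logSinhc_div_add_langevin.le_map_sum (t := s') (w := fun i => d i / D)
    (p := fun i => d i * t / 2) (fun i hi => (div_pos (hpos' i hi) hpos).le)
    (by rw [← Finset.sum_div, e1, div_self hpos.ne'])
    (fun i hi => by have := hpos' i hi; exact (by positivity : 0 < d i * t / 2))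
  have e4 : ∑ i ∈ s', (d i / D) • (d i * t / 2) = (∑ i ∈ s, d i ^ 2) / D * t / 2 := by
    rw [← e2, Finset.sum_div, Finset.sum_mul, Finset.sum_div]
    refine Finset.sum_congr rfl fun i _ => ?_
    rw [smul_eq_mul]; ring
  rw [e4] at hJ
  have hr : ∀ x : ℝ, 0 < x → rioEll x = x / 2 * (logSinhc (x / 2) / (x / 2) + langevin (x / 2)) := by
    intro x hx
    have := rioEll_two_mul (half_pos hx)
    rw [mul_div_cancel₀ x two_ne_zero] at this
    rw [this]
    field_simp
  rw [← e3, hr _ (by positivity)]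
  calc ∑ i ∈ s', rioEll (d i * t) = t * D / 2 * ∑ i ∈ s', (d i / D) •
        (logSinhc (d i * t / 2) / (d i * t / 2) + langevin (d i * t / 2)) := by
        rw [Finset.mul_sum]
        refine Finset.sum_congr rfl fun i hi => ?_
        have := hpos' i hi
        rw [hr _ (by positivity), smul_eq_mul]
        field_simp
    _ ≤ t * D / 2 * _ := mul_le_mul_of_nonneg_left hJ (by positivity)
    _ = _ := by
        field_simp

/-! ### Lower bounds for the Young transform -/

theorem neg_log_one_sub_le {y : ℝ} (h0 : 0 ≤ y) (h1 : y ≤ 1 / 2) :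
    -Real.log (1 - y) ≤ y + y ^ 2 / 2 + y ^ 3 / 3 + y ^ 4 / 2 := by
  have hmono : MonotoneOn (fun y => y + y ^ 2 / 2 + y ^ 3 / 3 + y ^ 4 / 2 + Real.log (1 - y))
      (Icc 0 (1 / 2)) := by
    have hd : ∀ x ∈ Icc (0 : ℝ) (1 / 2), HasDerivAt
        (fun y => y + y ^ 2 / 2 + y ^ 3 / 3 + y ^ 4 / 2 + Real.log (1 - y))
        (x ^ 3 * (1 - 2 * x) / (1 - x)) x := by
      intro x hx
      have hne : 1 - x ≠ 0 := by linarith [hx.2]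
      have := (((((hasDerivAt_id x).add ((hasDerivAt_pow 2 x).div_const 2)).add
        ((hasDerivAt_pow 3 x).div_const 3)).add ((hasDerivAt_pow 4 x).div_const 2))).add
        (((hasDerivAt_id x).const_sub 1).log hne)
      refine this.congr_deriv ?_
      norm_num
      field_simp
      ring
    refine monotoneOn_of_deriv_nonneg (convex_Icc _ _)
      (fun y hy => (hd y hy).continuousAt.continuousWithinAt) ?_ ?_
    · intro y hy
      exact (hd y (interior_subset hy)).differentiableAt.differentiableWithinAt
    · intro y hy
      have hy := interior_subset hy
      rw [(hd y hy).deriv]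
      have : 0 ≤ 1 - 2 * y := by linarith [hy.2]
      have : 0 ≤ 1 - y := by linarith [hy.2]
      have := hy.1
      positivity
  have := hmono ⟨le_rfl, by norm_num⟩ ⟨h0, h1⟩ h0
  norm_num at this
  linarith

/-- For `y ≤ 1 / 2` the test point `t = 4 y` suffices in the supremum that defines `ℓ*(y)`. It is the
maximizer for the leading term `t² / 8` of `ℓ`. -/
theorem le_mul_sub_rioEll_of_le_half {y : ℝ} (h0 : 0 < y) (h1 : y ≤ 1 / 2) :
    (y ^ 2 - 2 * y) * Real.log (1 - y) ≤ y * (4 * y) - rioEll (4 * y) := by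
  have hE := rioEll_two_mul_le (s := 2 * y) (by linarith) (by linarith)
  rw [show 2 * (2 * y) = 4 * y by ring] at hE
  have hL := mul_le_mul_of_nonneg_left (neg_log_one_sub_le h0.le h1)
    (by nlinarith : 0 ≤ 2 * y - y ^ 2)
  have : 0 ≤ y ^ 4 * (5 / 18 - 2 / 3 * y + (1 / 2 - 64 / 405) * y ^ 2) :=
    mul_nonneg (by positivity) (by nlinarith)
  nlinarith

/-- A bound for the part of `ℓ(t)` that decays exponentially. -/
theorem div_exp_sub_one_add_log_le {t : ℝ} (ht : 2 ≤ t) :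
    t / (Real.exp t - 1) + Real.log (1 - Real.exp (-t)) ≤ Real.exp (-t) * (t - 0.754) := by
  set w := Real.exp (-t) with hw
  have hw0 : 0 < w := Real.exp_pos _
  have hexp1 : (2.7182818283 : ℝ) < Real.exp 1 := Real.exp_one_gt_d9
  have he2 : Real.exp 2 = Real.exp 1 ^ 2 := by rw [← Real.exp_nat_mul]; norm_num
  have he2' : (7.389 : ℝ) ≤ Real.exp 2 := by rw [he2]; nlinarith
  have hwt : 7.389 * (t - 1) * w ≤ 1 := by
    have h1 : t - 1 ≤ Real.exp (t - 2) := by linarith [Real.add_one_le_exp (t - 2)]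
    have h2 : Real.exp 2 * Real.exp (t - 2) * w = 1 := by
      rw [hw, ← Real.exp_add, ← Real.exp_add]; simp
    calc 7.389 * (t - 1) * w ≤ Real.exp 2 * Real.exp (t - 2) * w := by
          gcongr
          linarith
      _ = 1 := h2
  have hw1 : w ≤ 0.1354 := by nlinarith
  have hlog : Real.log (1 - w) ≤ -w - w ^ 2 / 2 := by
    have h := Real.hasSum_pow_div_log_of_abs_lt_one (x := w) (by rw [abs_of_pos hw0]; linarith)
    have := sum_le_hasSum (Finset.range 2) (fun i _ => by positivity) h
    simp [Finset.sum_range_succ] at this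
    linarith
  have hE : t / (Real.exp t - 1) = t * w / (1 - w) := by
    have : Real.exp t = 1 / w := by rw [hw, Real.exp_neg]; simp
    rw [this]
    have : 1 - w ≠ 0 := by linarith
    field_simp
  have h3 : t * w / (1 - w) ≤ t * w + 1.157 * t * w ^ 2 := by
    rw [div_le_iff₀ (by linarith)]
    have : 0 ≤ t * w ^ 2 * (0.157 - 1.157 * w) := mul_nonneg (by positivity) (by linarith)
    nlinarith
  rw [hE]
  -- the constant `0.754` of the statement is `1 - 0.246`, with `0.246 ≥ w (1.157 t - 1/2)` for `t ≥ 2`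
  have h4 : w * (1.157 * t - 0.5) ≤ 0.246 := by nlinarith
  nlinarith

/-- For `y ≥ 1 / 2` the test point `t = 1 / (1 - y)` suffices in the supremum that defines `ℓ*(y)`. It
is the maximizer when `ℓ(t)` is replaced by its main part `t - log t - 1`; what is left to show is
that the exponentially small rest of `ℓ(t)` is at most `log t / t²`. -/
theorem le_mul_sub_rioEll_of_half_le {y : ℝ} (h0 : 1 / 2 ≤ y) (h1 : y < 1) :
    (y ^ 2 - 2 * y) * Real.log (1 - y) ≤ y * (1 / (1 - y)) - rioEll (1 / (1 - y)) := by
  obtain ⟨t, ht, rfl⟩ : ∃ t : ℝ, 2 ≤ t ∧ y = 1 - 1 / t :=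
    ⟨1 / (1 - y), by rw [le_div_iff₀ (by linarith)]; linarith, by simp⟩
  have ht0 : 0 < t := by linarith
  rw [sub_sub_cancel, one_div_one_div, Real.log_div one_ne_zero ht0.ne', Real.log_one]
  unfold rioEll
  rw [if_neg ht0.ne']
  have hexp1 : (2.7182818283 : ℝ) < Real.exp 1 := Real.exp_one_gt_d9
  have he2 : Real.exp 2 = Real.exp 1 ^ 2 := by rw [← Real.exp_nat_mul]; norm_num
  have he2' : (7.389 : ℝ) ≤ Real.exp 2 := by rw [he2]; nlinarith
  have hA := div_exp_sub_one_add_log_le ht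
  -- expanding `exp` and `log` at `2` reduces the claim to a polynomial inequality in `u = t - 2`
  obtain ⟨u, hu, rfl⟩ : ∃ u : ℝ, 0 ≤ u ∧ t = 2 + u := ⟨t - 2, by linarith, by ring⟩
  have hexp : 7.389 * (1 + u + u ^ 2 / 2 + u ^ 3 / 6) ≤ Real.exp (2 + u) := by
    rw [Real.exp_add]
    have h := Real.sum_le_exp_of_nonneg hu 4
    simp [Finset.sum_range_succ, Nat.factorial] at h
    gcongr
  have hlog : 0.6931 + 2 * u / (4 + u) ≤ Real.log (2 + u) := by
    have h2 := Real.log_two_gt_d9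
    have h3 := Real.le_log_one_add_of_nonneg (x := u / 2) (by linarith)
    have h4 : Real.log (2 + u) = Real.log 2 + Real.log (1 + u / 2) := by
      rw [← Real.log_mul two_ne_zero (by positivity)]; ring_nf
    have h5 : 2 * (u / 2) / (u / 2 + 2) = 2 * u / (4 + u) := by field_simp; ring
    rw [h5] at h3
    linarith
  have hkey : (2 + u) ^ 2 * (2 + u - 0.754) ≤ Real.exp (2 + u) * Real.log (2 + u) := by
    have h1 : (2 + u) ^ 2 * (2 + u - 0.754) ≤
        (7.389 * (1 + u + u ^ 2 / 2 + u ^ 3 / 6)) * (0.6931 + 2 * u / (4 + u)) := by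
      have : 0.6931 + 2 * u / (4 + u) = (0.6931 * (4 + u) + 2 * u) / (4 + u) := by field_simp
      rw [this, ← mul_div_assoc, le_div_iff₀ (by positivity)]
      have : 0 ≤ u ^ 3 := by positivity
      have : 0 ≤ u ^ 4 := by positivity
      nlinarith [sq_nonneg (u - 1), sq_nonneg (u - 1.5)]
    exact h1.trans (mul_le_mul hexp hlog (by positivity) (Real.exp_pos _).le)
  have hB : Real.exp (-(2 + u)) * (2 + u - 0.754) ≤ Real.log (2 + u) / (2 + u) ^ 2 := by
    rw [le_div_iff₀ (by positivity), Real.exp_neg, mul_assoc, inv_mul_le_iff₀ (Real.exp_pos _)]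
    linarith
  have h6 := hA.trans hB
  rw [div_eq_mul_inv] at h6
  have h7 : ((1 - 1 / (2 + u)) ^ 2 - 2 * (1 - 1 / (2 + u))) * (0 - Real.log (2 + u)) =
    Real.log (2 + u) - Real.log (2 + u) / (2 + u) ^ 2 := by
    field_simp
    ring
  have h8 : (1 - 1 / (2 + u)) * (2 + u) = 1 + u := by field_simp; ring
  rw [h7, h8]
  linarith

theorem coe_le_rioEllStar {x t : ℝ} (ht : 0 < t) :
    ((x * t - rioEll t : ℝ) : EReal) ≤ rioEllStar x :=
  le_iSup (fun t : {t : ℝ // 0 < t} => ((x * t.1 - rioEll t.1 : ℝ) : EReal)) ⟨t, ht⟩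

theorem rioEllStar_one : rioEllStar 1 = ⊤ := by
  rw [EReal.eq_top_iff_forall_lt]
  intro y
  have ht : 0 < Real.exp (y + 1) := Real.exp_pos _
  refine lt_of_lt_of_le (EReal.coe_lt_coe_iff.2 ?_) (coe_le_rioEllStar ht)
  set t := Real.exp (y + 1) with htdef
  have hlog : Real.log t = y + 1 := Real.log_exp _
  have h1 : t * (Real.exp t - 1)⁻¹ ≤ 1 := by
    have := Real.add_one_le_exp t
    rw [← div_eq_mul_inv, div_le_one (by linarith)]
    linarith
  have h2 : Real.log (1 - Real.exp (-t)) ≤ 0 := by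
    apply Real.log_nonpos
    · have : Real.exp (-t) < 1 := by rw [Real.exp_lt_one_iff]; linarith
      linarith
    · linarith [Real.exp_pos (-t)]
  unfold rioEll
  rw [if_neg ht.ne', hlog]
  linarith

theorem le_rioEllStar {y : ℝ} (h0 : 0 ≤ y) (h1 : y < 1) :
    (((y ^ 2 - 2 * y) * Real.log (1 - y) : ℝ) : EReal) ≤ rioEllStar y := by
  rcases h0.eq_or_lt with rfl | h0
  · -- the supremum is approached as `t → 0`
    simp only [sub_zero, Real.log_one, mul_zero, EReal.coe_zero]
    refine le_of_forall_lt fun c hc => ?_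
    obtain ⟨r, hcr, hr⟩ := EReal.lt_iff_exists_real_btwn.1 hc
    have hr : r < 0 := by exact_mod_cast hr
    set s := min 1 (-r) with hs
    have hs0 : 0 < s := lt_min one_pos (by linarith)
    have hs1 : s ≤ 1 := min_le_left _ _
    have hsr : s ≤ -r := min_le_right _ _
    refine hcr.trans_le (le_trans ?_ (coe_le_rioEllStar (t := 2 * s) (by linarith)))
    rw [EReal.coe_le_coe_iff]
    have := rioEll_two_mul_le hs0 (by linarith)
    have : s ^ 4 * s ^ 2 ≤ s ^ 4 * 1 := by gcongr; nlinarith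
    nlinarith [pow_pos hs0 4]
  · rcases le_total y (1 / 2) with h | h
    · exact (EReal.coe_le_coe_iff.2 (le_mul_sub_rioEll_of_le_half h0 h)).trans
        (coe_le_rioEllStar (by linarith))
    · exact (EReal.coe_le_coe_iff.2 (le_mul_sub_rioEll_of_half_le h h1)).trans
        (coe_le_rioEllStar (by have : 0 < 1 - y := by linarith
                               positivity))

/-- The explicit form of the exponential bound. At `y = 1` both sides vanish, since `ℓ*(1) = ∞`. -/
theorem exp_neg_mul_rioEllStar_le {a y : ℝ} (ha : 0 < a) (h0 : 0 ≤ y) (h1 : y ≤ 1) :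
    EReal.exp (-((a : EReal) * rioEllStar y)) ≤
      ENNReal.ofReal ((1 - y) ^ (a * (2 - y) * y)) := by
  rcases h1.eq_or_lt with rfl | h1
  · rw [rioEllStar_one, EReal.coe_mul_top_of_pos ha]
    simp
  · have h := le_rioEllStar h0 h1
    have h2 : 0 < 1 - y := by linarith
    rw [Real.rpow_def_of_pos h2, ← EReal.exp_coe]
    refine EReal.exp_monotone ?_
    rw [← EReal.neg_le_neg_iff, neg_neg, ← EReal.coe_neg]
    refine le_trans ?_ (mul_le_mul_of_nonneg_left h (by exact_mod_cast ha.le))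
    rw [← EReal.coe_mul, EReal.coe_le_coe_iff]
    apply le_of_eq
    ring

/-- Optimization over `t` of a family of exponential bounds; it also covers the case in which the
supremum is infinite. -/
theorem le_mul_exp_neg_mul_rioEllStar {b : ENNReal} {c a y : ℝ} (hc : 0 < c) (ha : 0 < a)
    (h : ∀ t : ℝ, 0 < t → b ≤ ENNReal.ofReal (c * Real.exp (-(a * (y * t - rioEll t))))) :
    b ≤ ENNReal.ofReal c * EReal.exp (-((a : EReal) * rioEllStar y)) := by
  have hbtop : b ≠ ⊤ := ((h 1 one_pos).trans_lt ENNReal.ofReal_lt_top).ne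
  rcases eq_or_ne b 0 with rfl | hb0
  · exact bot_le
  have hb : 0 < b.toReal := ENNReal.toReal_pos hb0 hbtop
  have h1 : rioEllStar y ≤ ((-(Real.log (b.toReal / c)) / a : ℝ) : EReal) := by
    refine iSup_le fun t => EReal.coe_le_coe_iff.2 ?_
    have h2 := ENNReal.toReal_le_of_le_ofReal (by positivity) (h t.1 t.2)
    have h3 : Real.log (b.toReal / c) ≤ -(a * (y * t.1 - rioEll t.1)) := by
      rw [Real.log_le_iff_le_exp (by positivity), div_le_iff₀ hc]
      linarith
    rw [le_div_iff₀ ha]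
    linarith
  have h4 : ((Real.log (b.toReal / c) : ℝ) : EReal) ≤ -((a : EReal) * rioEllStar y) := by
    rw [← EReal.neg_le_neg_iff, neg_neg, ← EReal.coe_neg]
    refine (mul_le_mul_of_nonneg_left h1 (by exact_mod_cast ha.le)).trans ?_
    rw [← EReal.coe_mul, EReal.coe_le_coe_iff]
    apply le_of_eq
    field_simp
  calc b = ENNReal.ofReal c * ENNReal.ofReal (b.toReal / c) := by
        rw [← ENNReal.ofReal_mul hc.le, mul_div_cancel₀ _ hc.ne', ENNReal.ofReal_toReal hbtop]
    _ = ENNReal.ofReal c * EReal.exp ((Real.log (b.toReal / c) : ℝ) : EReal) := by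
        rw [EReal.exp_coe, Real.exp_log (by positivity)]
    _ ≤ _ := by
        gcongr

/-- The comparison with Hoeffding's exponential: `-log (1 - y) ≥ 2 y / (2 - y)`. -/
theorem one_sub_rpow_le_exp {a y : ℝ} (ha : 0 < a) (h0 : 0 ≤ y) (h1 : y ≤ 1) :
    (1 - y) ^ (a * (2 - y) * y) ≤ Real.exp (-(2 * a * y ^ 2)) := by
  rcases h1.eq_or_lt with rfl | h1
  · rw [sub_self, Real.zero_rpow (by norm_num; exact ha.ne')]
    exact (Real.exp_pos _).le
  have h2 : 0 < 1 - y := by linarith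
  rw [Real.rpow_def_of_pos h2, Real.exp_le_exp]
  have h3 := Real.le_log_one_add_of_nonneg (x := y / (1 - y)) (by positivity)
  have h4 : 1 + y / (1 - y) = (1 - y)⁻¹ := by field_simp; ring
  have h5 : 2 * (y / (1 - y)) / (y / (1 - y) + 2) = 2 * y / (2 - y) := by
    have : 2 - y ≠ 0 := by linarith
    have : y / (1 - y) + 2 = (2 - y) / (1 - y) := by field_simp; ring
    rw [this]
    field_simp
  rw [h4, h5, Real.log_inv, div_le_iff₀ (by linarith)] at h3
  have := mul_le_mul_of_nonneg_left h3 (by positivity : 0 ≤ a * y)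
  nlinarith

/-- This turns the constant `e` of the maximal inequality into the factor `(1 - α)⁻¹` and the power
`α`. -/
theorem min_one_exp_one_mul_le {q α : ℝ} (hq : 0 < q) (h0 : 0 < α) (h1 : α < 1) :
    min 1 (Real.exp 1 * q) ≤ (1 - α)⁻¹ * q ^ α := by
  have hα : 0 < 1 - α := by linarith
  rw [inv_mul_eq_div, le_div_iff₀ hα]
  have hb : 1 - α ≤ Real.exp (-α) := by linarith [Real.add_one_le_exp (-α)]
  have hq' : q ^ α = Real.exp (α * Real.log q) := by rw [Real.rpow_def_of_pos hq, mul_comm]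
  rw [hq']
  rcases le_total (-1) (Real.log q) with h | h
  · calc min 1 (Real.exp 1 * q) * (1 - α) ≤ 1 * Real.exp (-α) := by
          gcongr; exact min_le_left _ _
      _ ≤ _ := by
          rw [one_mul, Real.exp_le_exp]
          nlinarith
  · calc min 1 (Real.exp 1 * q) * (1 - α) ≤ (Real.exp 1 * q) * Real.exp (-α) := by
          gcongr; exact min_le_right _ _
      _ = Real.exp (1 + Real.log q - α) := by
          rw [sub_eq_add_neg, Real.exp_add, Real.exp_add, Real.exp_log hq]
      _ ≤ _ := by
          rw [Real.exp_le_exp]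
          nlinarith

/-! ### The exponential moment of one bounded variable -/

/-- By convexity the worst case is a variable with values `m` and `M`. For it, `log z` is
bounded by the tangent `log z₀ + z / z₀ - 1` at the point `z₀` where the logarithm of the
two-point transform is largest among all centred two-point laws on an interval of length
`M - m`. -/
theorem mgf_le_exp_rioEll {Ω : Type*} [MeasurableSpace Ω] {μ : Measure Ω} [IsProbabilityMeasure μ]
    {X : Ω → ℝ} {m M t : ℝ} (hX : Measurable X) (hmean : ∫ ω, X ω ∂μ = 0)
    (hb : ∀ᵐ ω ∂μ, m ≤ X ω ∧ X ω ≤ M) (ht : 0 ≤ t) :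
    mgf X μ t ≤ Real.exp (rioEll ((M - m) * t)) := by
  have hmM : m ≤ M := by
    obtain ⟨ω, h⟩ := hb.exists
    exact h.1.trans h.2
  rcases ht.eq_or_lt with rfl | ht
  · simp [rioEll]
  rcases hmM.eq_or_lt with rfl | hmM
  · have h : X =ᵐ[μ] fun _ => m := by
      filter_upwards [hb] with ω h using le_antisymm h.2 h.1
    have hm : m = 0 := by
      rw [integral_congr_ae h] at hmean
      simpa using hmean
    subst hm
    rw [mgf_congr h]
    simp [rioEll]
  have hΔ : 0 < M - m := sub_pos.2 hmM
  have hXi : Integrable X μ := Integrable.of_mem_Icc m M hX.aemeasurable hb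
  have hle : mgf X μ t ≤ ∫ ω, ((M - X ω) / (M - m) * Real.exp (t * m)
      + (X ω - m) / (M - m) * Real.exp (t * M)) ∂μ := by
    refine integral_mono_ae ?_ ?_ ?_
    · exact integrable_exp_mul_of_mem_Icc hX.aemeasurable hb
    · fun_prop
    · filter_upwards [hb] with ω h
      have := convexOn_exp.2 (mem_univ (t * m)) (mem_univ (t * M))
        (div_nonneg (sub_nonneg.2 h.2) hΔ.le) (div_nonneg (sub_nonneg.2 h.1) hΔ.le)
        (by field_simp; ring)
      simp only [smul_eq_mul] at this
      refine le_trans (le_of_eq ?_) this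
      congr 1
      field_simp
      ring
  have hint : ∫ ω, ((M - X ω) / (M - m) * Real.exp (t * m)
      + (X ω - m) / (M - m) * Real.exp (t * M)) ∂μ
      = M / (M - m) * Real.exp (t * m) - m / (M - m) * Real.exp (t * M) := by
    rw [integral_add (by fun_prop) (by fun_prop), integral_mul_const, integral_mul_const,
      integral_div, integral_div, integral_sub (by fun_prop) (by fun_prop),
      integral_sub (by fun_prop) (by fun_prop), hmean]
    simp
    ring
  rw [hint] at hle
  refine hle.trans ?_
  set p := -m / (M - m) with hp
  set τ := (M - m) * t with hτ
  have hτ0 : 0 < τ := by positivity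
  have hE : 0 < Real.exp τ - 1 := by linarith [Real.add_one_le_exp τ]
  -- `z₀` is the value of `z = 1 + p (e^τ - 1)` at the maximizing `p`
  set z₀ := (Real.exp τ - 1) / τ with hz₀
  have hz₀pos : 0 < z₀ := by positivity
  have e1 : M / (M - m) * Real.exp (t * m) - m / (M - m) * Real.exp (t * M)
      = Real.exp (-(p * τ)) * (1 + p * (Real.exp τ - 1)) := by
    have h1 : -(p * τ) = t * m := by rw [hp, hτ]; field_simp
    have h2 : t * M = t * m + τ := by rw [hτ]; ring
    have h3 : M / (M - m) = 1 - p := by rw [hp]; field_simp; ring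
    have h4 : m / (M - m) = -p := by rw [hp]; ring
    rw [h1, h2, h3, h4, Real.exp_add]
    ring
  have e2 : 1 + p * (Real.exp τ - 1) ≤
      z₀ * Real.exp (τ * (Real.exp τ - 1)⁻¹ + p * τ - 1) := by
    have h1 := Real.add_one_le_exp (τ * (Real.exp τ - 1)⁻¹ + p * τ - 1)
    calc 1 + p * (Real.exp τ - 1) = z₀ * (τ * (Real.exp τ - 1)⁻¹ + p * τ - 1 + 1) := by
          rw [hz₀]; field_simp; ring
      _ ≤ _ := by gcongr
  have e3 : rioEll τ = Real.log z₀ + (τ * (Real.exp τ - 1)⁻¹ - 1) := by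
    have h1 : Real.log (1 - Real.exp (-τ)) = Real.log (Real.exp τ - 1) - τ := by
      have : 1 - Real.exp (-τ) = (Real.exp τ - 1) * Real.exp (-τ) := by
        rw [sub_mul, ← Real.exp_add]; simp
      rw [this, Real.log_mul hE.ne' (Real.exp_pos _).ne', Real.log_exp]
      ring
    unfold rioEll
    rw [if_neg hτ0.ne', h1, hz₀, Real.log_div hE.ne' hτ0.ne']
    ring
  rw [e1, e3, Real.exp_add, Real.exp_log hz₀pos]
  calc Real.exp (-(p * τ)) * (1 + p * (Real.exp τ - 1))
      ≤ Real.exp (-(p * τ)) * (z₀ * Real.exp (τ * (Real.exp τ - 1)⁻¹ + p * τ - 1)) := by gcongr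
    _ = z₀ * (Real.exp (-(p * τ)) * Real.exp (τ * (Real.exp τ - 1)⁻¹ + p * τ - 1)) := by ring
    _ = _ := by
        rw [← Real.exp_add]
        ring_nf

/-! ### The walk reflected at zero -/

/-- The maximum of `0` and of the sums `a k + ⋯ + a (k + l - 1)`, `1 ≤ l ≤ j`, defined by the
recursion that splits off the first term. This order of recursion makes it a nondecreasing function
of the later terms. -/
def reflectedWalk (a : ℕ → ℝ) : ℕ → ℕ → ℝ
  | _, 0 => 0
  | k, j + 1 => max 0 (a k + reflectedWalk a (k + 1) j)

theorem reflectedWalk_nonneg (a : ℕ → ℝ) (k j : ℕ) : 0 ≤ reflectedWalk a k j := by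
  cases j with
  | zero => exact le_rfl
  | succ j => exact le_max_left _ _

theorem reflectedWalk_mono (k j : ℕ) : Monotone fun a : ℕ → ℝ => reflectedWalk a k j := by
  induction j generalizing k with
  | zero => exact monotone_const
  | succ j ih => exact fun a b h => max_le_max le_rfl (add_le_add (h k) (ih (k + 1) h))

theorem reflectedWalk_congr {a b : ℕ → ℝ} {k j : ℕ} (h : ∀ i ∈ Finset.Ico k (k + j), a i = b i) :
    reflectedWalk a k j = reflectedWalk b k j := by
  induction j generalizing k with
  | zero => rfl
  | succ j ih =>
    simp only [reflectedWalk]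
    rw [h k (by simp), ih fun i hi => h i (by simp at hi ⊢; omega)]

theorem measurable_reflectedWalk {Ω : Type*} [MeasurableSpace Ω] {X : ℕ → Ω → ℝ} {k j : ℕ}
    (h : ∀ i ∈ Finset.Ico k (k + j), Measurable (X i)) :
    Measurable fun ω => reflectedWalk (fun i => X i ω) k j := by
  induction j generalizing k with
  | zero => exact measurable_const
  | succ j ih =>
    exact measurable_const.max ((h k (by simp)).add
      (ih fun i hi => h i (by simp at hi ⊢; omega)))

theorem sum_le_reflectedWalk (a : ℕ → ℝ) {k j l : ℕ} (hl : l ≤ j) :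
    ∑ i ∈ Finset.Ico k (k + l), a i ≤ reflectedWalk a k j := by
  induction j generalizing k l with
  | zero => simp [Nat.le_zero.1 hl, reflectedWalk]
  | succ j ih =>
    cases l with
    | zero => simpa using reflectedWalk_nonneg a k (j + 1)
    | succ l =>
      rw [Finset.sum_eq_sum_Ico_succ_bot (by omega), show k + (l + 1) = k + 1 + l by ring]
      exact le_max_of_le_right (add_le_add le_rfl (ih (by omega)))

theorem maxPartialSum_le_reflectedWalk {Ω : Type*} (X : ℕ → Ω → ℝ) {n : ℕ} (hn : 1 ≤ n) (ω : Ω) :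
    maxPartialSum X n hn ω ≤ reflectedWalk (fun i => X i ω) 1 n := by
  refine Finset.sup'_le _ _ fun k hk => ?_
  have hk := (Finset.mem_Icc.1 hk).2
  have : Finset.Icc 1 k = Finset.Ico 1 (1 + k) := by
    ext i; simp; omega
  rw [partialSum, this]
  exact sum_le_reflectedWalk (fun i => X i ω) hk

/-! ### Negative association and the maximal inequality -/

section NA

variable {Ω : Type*} [MeasurableSpace Ω] {μ : Measure Ω} [IsProbabilityMeasure μ]

theorem monotone_indicator_Ioi (r : ℝ) : Monotone ((Ioi r).indicator (1 : ℝ → ℝ)) := by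
  intro x y h
  by_cases hx : x ∈ Ioi r
  · have hy : y ∈ Ioi r := lt_of_lt_of_le (mem_Ioi.1 hx) h
    rw [indicator_of_mem hx, indicator_of_mem hy]
    exact le_rfl
  · rw [indicator_of_notMem hx]
    exact indicator_nonneg (fun _ _ => zero_le_one) y

/-- Monotone functions of disjoint blocks are negatively quadrant dependent. -/
theorem NegativelyAssociated.measure_inter_le {ι : Type*} {X : ι → Ω → ℝ} {s : Finset ι}
    (h : NegativelyAssociated X s μ) (hX : ∀ i ∈ s, Measurable (X i))
    {A₁ A₂ : Finset ι} (h₁ : A₁ ⊆ s) (h₂ : A₂ ⊆ s) (hd : Disjoint A₁ A₂)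
    {g₁ : (A₁ → ℝ) → ℝ} {g₂ : (A₂ → ℝ) → ℝ} (hg₁ : Monotone g₁) (hg₂ : Monotone g₂)
    (mg₁ : Measurable g₁) (mg₂ : Measurable g₂) (a b : ℝ) :
    μ ({ω | a < g₁ fun i => X i ω} ∩ {ω | b < g₂ fun i => X i ω}) ≤
      μ {ω | a < g₁ fun i => X i ω} * μ {ω | b < g₂ fun i => X i ω} := by
  have mX₁ : Measurable fun ω => g₁ fun i => X i ω :=
    mg₁.comp (measurable_pi_lambda _ fun i => hX i (h₁ i.2))
  have mX₂ : Measurable fun ω => g₂ fun i => X i ω :=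
    mg₂.comp (measurable_pi_lambda _ fun i => hX i (h₂ i.2))
  set E := {ω | a < g₁ fun i => X i ω} with hE
  set F := {ω | b < g₂ fun i => X i ω} with hF
  have mE : MeasurableSet E := measurableSet_lt measurable_const mX₁
  have mF : MeasurableSet F := measurableSet_lt measurable_const mX₂
  have e₁ : (fun ω => (Ioi a).indicator (1 : ℝ → ℝ) (g₁ fun i => X i ω)) =
    E.indicator (1 : Ω → ℝ) := rfl
  have e₂ : (fun ω => (Ioi b).indicator (1 : ℝ → ℝ) (g₂ fun i => X i ω)) =
    F.indicator (1 : Ω → ℝ) := rfl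
  have e₃ : E.indicator (1 : Ω → ℝ) * F.indicator 1 = (E ∩ F).indicator 1 := by
    rw [inter_indicator_one]
  have iE : Integrable (E.indicator (1 : Ω → ℝ)) μ := (integrable_const (1 : ℝ)).indicator mE
  have iF : Integrable (F.indicator (1 : Ω → ℝ)) μ := (integrable_const (1 : ℝ)).indicator mF
  have iEF : Integrable ((E ∩ F).indicator (1 : Ω → ℝ)) μ :=
    (integrable_const (1 : ℝ)).indicator (mE.inter mF)
  have key := h A₁ A₂ h₁ h₂ hd
    (fun v => (Ioi a).indicator 1 (g₁ v)) (fun v => (Ioi b).indicator 1 (g₂ v))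
    ((monotone_indicator_Ioi a).comp hg₁) ((monotone_indicator_Ioi b).comp hg₂)
    ((measurable_one.indicator measurableSet_Ioi).comp mg₁)
    ((measurable_one.indicator measurableSet_Ioi).comp mg₂)
    (by rw [e₁]; exact iE) (by rw [e₂]; exact iF)
    (by
      change Integrable (E.indicator (1 : Ω → ℝ) * F.indicator 1) μ
      rw [e₃]; exact iEF)
  rw [e₁, e₂, covariance_eq_sub] at key
  · rw [e₃, integral_indicator_one (mE.inter mF), integral_indicator_one mE,
      integral_indicator_one mF, sub_nonpos] at key
    rw [← ENNReal.toReal_le_toReal (by finiteness) (by finiteness), ENNReal.toReal_mul]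
    exact key
  · exact (memLp_const 1).indicator mE
  · exact (memLp_const 1).indicator mF

/-- For negatively quadrant dependent `U`, `V`, the expectation of `(U + V - u)⁺` is at most its value
for an independent pair with the same marginals, since
`(x + y - u)⁺ = ∫ 𝟙(s < x) 𝟙(u - s < y) ds`. -/
theorem lintegral_ofReal_add_sub_le {U V : Ω → ℝ} (hU : Measurable U) (hV : Measurable V)
    (h : ∀ a b : ℝ, μ ({ω | a < U ω} ∩ {ω | b < V ω}) ≤ μ {ω | a < U ω} * μ {ω | b < V ω})
    (u : ℝ) :
    ∫⁻ ω, ENNReal.ofReal (U ω + V ω - u) ∂μ ≤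
      ∫⁻ ω, ∫⁻ ω', ENNReal.ofReal (U ω + V ω' - u) ∂μ ∂μ := by
  have hrep : ∀ x y : ℝ, ENNReal.ofReal (x + y - u) =
      ∫⁻ s : ℝ, (Iio x).indicator 1 s * (Ioi (u - y)).indicator 1 s := by
    intro x y
    have : (fun s : ℝ => (Iio x).indicator (1 : ℝ → ENNReal) s * (Ioi (u - y)).indicator 1 s) =
        (Ioo (u - y) x).indicator 1 := by
      rw [← Ioi_inter_Iio, inter_comm, inter_indicator_one]; rfl
    rw [this, lintegral_indicator_one measurableSet_Ioo, Real.volume_Ioo]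
    congr 1; ring
  have mU : Measurable fun p : Ω × ℝ => (Iio (U p.1)).indicator (1 : ℝ → ENNReal) p.2 :=
    measurable_one.indicator (measurableSet_lt measurable_snd (hU.comp measurable_fst))
  have mV : Measurable fun p : Ω × ℝ => (Ioi (u - V p.1)).indicator (1 : ℝ → ENNReal) p.2 :=
    measurable_one.indicator
      (measurableSet_lt (measurable_const.sub (hV.comp measurable_fst)) measurable_snd)
  have mU' : ∀ s : ℝ, Measurable fun ω => (Iio (U ω)).indicator (1 : ℝ → ENNReal) s := fun s =>
    mU.comp (measurable_id.prodMk measurable_const)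
  have mV' : ∀ s : ℝ, Measurable fun ω => (Ioi (u - V ω)).indicator (1 : ℝ → ENNReal) s :=
    fun s => mV.comp (measurable_id.prodMk measurable_const)
  have eU : ∀ s : ℝ, ∫⁻ ω, (Iio (U ω)).indicator (1 : ℝ → ENNReal) s ∂μ = μ {ω | s < U ω} :=
    fun s => lintegral_indicator_one (measurableSet_lt measurable_const hU)
  have eV : ∀ s : ℝ, ∫⁻ ω, (Ioi (u - V ω)).indicator (1 : ℝ → ENNReal) s ∂μ =
      μ {ω | u - s < V ω} := by
    intro s
    rw [← lintegral_indicator_one (measurableSet_lt measurable_const hV)]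
    refine lintegral_congr fun ω => ?_
    simp only [indicator, mem_Ioi, mem_ofPred_eq, sub_lt_comm, Pi.one_apply]
  simp_rw [hrep]
  rw [lintegral_lintegral_swap (mU.mul mV).aemeasurable]
  have hR : ∫⁻ ω, ∫⁻ ω', (∫⁻ s : ℝ, (Iio (U ω)).indicator 1 s * (Ioi (u - V ω')).indicator 1 s) ∂μ ∂μ
      = ∫⁻ s : ℝ, μ {ω | s < U ω} * μ {ω | u - s < V ω} := by
    have h1 : ∀ ω, ∫⁻ ω', (∫⁻ s : ℝ, (Iio (U ω)).indicator 1 s * (Ioi (u - V ω')).indicator 1 s) ∂μ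
        = ∫⁻ s : ℝ, (Iio (U ω)).indicator 1 s * μ {ω | u - s < V ω} := by
      intro ω
      rw [lintegral_lintegral_swap]
      · refine lintegral_congr fun s => ?_
        rw [lintegral_const_mul _ (mV' s), eV]
      · exact (((measurable_one.indicator measurableSet_Iio).comp measurable_snd).mul
          mV).aemeasurable
    simp_rw [h1]
    have mμ : Measurable fun s : ℝ => μ {ω | u - s < V ω} := by
      have : Measurable fun s : ℝ => ∫⁻ ω, (Ioi (u - V ω)).indicator (1 : ℝ → ENNReal) s ∂μ :=
        mV.lintegral_prod_left'
      simpa only [eV] using this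
    rw [lintegral_lintegral_swap (mU.mul (mμ.comp measurable_snd)).aemeasurable]
    refine lintegral_congr fun s => ?_
    rw [lintegral_mul_const _ (mU' s), eU]
  rw [hR]
  refine lintegral_mono fun s => ?_
  refine le_trans (le_of_eq ?_) (h s (u - s))
  rw [← lintegral_indicator_one ((measurableSet_lt measurable_const hU).inter
    (measurableSet_lt measurable_const hV))]
  refine lintegral_congr fun ω => ?_
  rw [inter_indicator_one]
  simp only [indicator, mem_Ioi, mem_Iio, mem_ofPred_eq, sub_lt_comm, Pi.mul_apply, Pi.one_apply]

/-- The hinge bound `E (T - u)⁺ ≤ e^{-t u} ∏ E e^{t X_i} / t` for the reflected walk `T`. The right-hand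
side reproduces itself when one more variable is split off and made independent. -/
theorem lintegral_reflectedWalk_sub_le {X : ℕ → Ω → ℝ} {n : ℕ}
    (hNA : NegativelyAssociated X (Finset.Icc 1 n) μ)
    (hX : ∀ i ∈ Finset.Icc 1 n, Measurable (X i)) {t : ℝ} (ht : 0 < t)
    (hint : ∀ i ∈ Finset.Icc 1 n, Integrable (fun ω => Real.exp (t * X i ω)) μ)
    (hmgf : ∀ i ∈ Finset.Icc 1 n, 1 ≤ mgf (X i) μ t)
    {k j : ℕ} (hk : 1 ≤ k) (hkj : k + j ≤ n + 1) (u : ℝ) :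
    ∫⁻ ω, ENNReal.ofReal (reflectedWalk (fun i => X i ω) k j - u) ∂μ ≤
      ENNReal.ofReal ((∏ i ∈ Finset.Ico k (k + j), mgf (X i) μ t) * Real.exp (-(t * u)) / t) := by
  induction j generalizing k u with
  | zero =>
    simp only [reflectedWalk, lintegral_const, measure_univ, mul_one, add_zero, Finset.Ico_self,
      Finset.prod_empty, one_mul]
    refine ENNReal.ofReal_le_ofReal ?_
    rw [le_div_iff₀ ht]
    linarith [Real.add_one_le_exp (-(t * u))]
  | succ j ih =>
    have hkn : k ∈ Finset.Icc 1 n := Finset.mem_Icc.2 ⟨hk, by omega⟩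
    have hsub : Finset.Ico (k + 1) (k + 1 + j) ⊆ Finset.Icc 1 n := fun i hi => by
      simp at hi ⊢; omega
    set A := ∏ i ∈ Finset.Ico (k + 1) (k + 1 + j), mgf (X i) μ t with hA
    have hA1 : 1 ≤ A := Finset.one_le_prod fun i hi => hmgf i (hsub hi)
    have hprod : ∏ i ∈ Finset.Ico k (k + (j + 1)), mgf (X i) μ t = mgf (X k) μ t * A := by
      rw [Finset.prod_eq_prod_Ico_succ_bot (by omega), hA, show k + (j + 1) = k + 1 + j by ring]
    rw [hprod]
    set T : Ω → ℝ := fun ω => reflectedWalk (fun i => X i ω) (k + 1) j with hT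
    have mT : Measurable T := measurable_reflectedWalk fun i hi => hX i (hsub hi)
    have mk := hX k hkn
    -- the two variables are negatively dependent
    have hdep : ∀ a b : ℝ, μ ({ω | a < X k ω} ∩ {ω | b < T ω}) ≤
        μ {ω | a < X k ω} * μ {ω | b < T ω} := by
      intro a b
      have hext : Monotone fun v : (Finset.Ico (k + 1) (k + 1 + j) → ℝ) => fun i : ℕ =>
          if h : i ∈ Finset.Ico (k + 1) (k + 1 + j) then v ⟨i, h⟩ else 0 := by
        intro v w hvw i
        dsimp only
        split_ifs
        · exact hvw _
        · exact le_rfl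
      have hT' : ∀ ω, T ω = reflectedWalk (fun i : ℕ =>
          if h : i ∈ Finset.Ico (k + 1) (k + 1 + j) then X i ω else 0) (k + 1) j :=
        fun ω => reflectedWalk_congr fun i hi => by simp only [hi, ↓reduceDIte]
      have := hNA.measure_inter_le hX (A₁ := {k}) (A₂ := Finset.Ico (k + 1) (k + 1 + j))
        (g₁ := fun v => v ⟨k, Finset.mem_singleton_self k⟩)
        (g₂ := fun v => reflectedWalk (fun i : ℕ =>
          if h : i ∈ Finset.Ico (k + 1) (k + 1 + j) then v ⟨i, h⟩ else 0) (k + 1) j)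
        (Finset.singleton_subset_iff.2 hkn) hsub (by simp)
        (fun v w h => h _) ((reflectedWalk_mono (k + 1) j).comp hext)
        (measurable_pi_apply _)
        (measurable_reflectedWalk fun i hi => by
          simp only [hi, ↓reduceDIte]; exact measurable_pi_apply _) a b
      simp only [← hT'] at this
      exact this
    have hstep : ∀ u : ℝ, ∫⁻ ω, ENNReal.ofReal (X k ω + T ω - u) ∂μ ≤
        ENNReal.ofReal (mgf (X k) μ t * A * Real.exp (-(t * u)) / t) := by
      intro u
      refine (lintegral_ofReal_add_sub_le mk mT hdep u).trans ?_
      calc ∫⁻ ω, ∫⁻ ω', ENNReal.ofReal (X k ω + T ω' - u) ∂μ ∂μ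
          ≤ ∫⁻ ω, ENNReal.ofReal (A * Real.exp (-(t * u)) / t * Real.exp (t * X k ω)) ∂μ := by
            refine lintegral_mono fun ω => ?_
            have := ih (k := k + 1) (by omega) (by omega) (u - X k ω)
            refine le_trans (le_of_eq ?_) (this.trans (le_of_eq ?_))
            · refine lintegral_congr fun ω' => ?_
              congr 1
              simp only [hT]; ring
            · congr 1
              rw [show -(t * (u - X k ω)) = -(t * u) + t * X k ω by ring, Real.exp_add]
              ring
        _ = ENNReal.ofReal (∫ ω, A * Real.exp (-(t * u)) / t * Real.exp (t * X k ω) ∂μ) :=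
            (ofReal_integral_eq_lintegral_ofReal ((hint k hkn).const_mul _)
              (ae_of_all _ fun ω => by positivity)).symm
        _ = _ := by
            rw [integral_const_mul]
            congr 1
            unfold mgf
            ring
    have hmax : ∀ u : ℝ, 0 ≤ u → ∀ ω, ENNReal.ofReal
        (reflectedWalk (fun i => X i ω) k (j + 1) - u) ≤ ENNReal.ofReal (X k ω + T ω - u) := by
      intro u hu ω
      simp only [reflectedWalk]
      rcases max_cases 0 (X k ω + reflectedWalk (fun i => X i ω) (k + 1) j) with h | h
      · rw [h.1, ENNReal.ofReal_of_nonpos (by linarith)]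
        exact bot_le
      · rw [h.1]
    -- for `u ≥ 0` the reflection at `0` is invisible; `u ≤ 0` reduces to `u = 0`,
    -- as the walk is nonnegative
    rcases le_total 0 u with hu | hu
    · exact (lintegral_mono (hmax u hu)).trans (hstep u)
    · calc ∫⁻ ω, ENNReal.ofReal (reflectedWalk (fun i => X i ω) k (j + 1) - u) ∂μ
          ≤ ∫⁻ ω, (ENNReal.ofReal (X k ω + T ω - 0) + ENNReal.ofReal (-u)) ∂μ := by
            refine lintegral_mono fun ω => ?_
            refine le_trans ?_ (add_le_add (hmax 0 le_rfl ω) le_rfl)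
            refine le_trans (le_of_eq ?_) ENNReal.ofReal_add_le
            congr 1; ring
        _ ≤ ENNReal.ofReal (mgf (X k) μ t * A / t) + ENNReal.ofReal (-u) := by
            rw [lintegral_add_right _ measurable_const]
            simpa using hstep 0
        _ ≤ _ := by
            have hB : 1 ≤ mgf (X k) μ t * A := one_le_mul_of_one_le_of_one_le (hmgf k hkn) hA1
            rw [← ENNReal.ofReal_add (by positivity) (by linarith)]
            refine ENNReal.ofReal_le_ofReal ?_
            rw [le_div_iff₀ ht, add_mul, div_mul_cancel₀ _ ht.ne']
            have h1 := Real.add_one_le_exp (-(t * u))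
            have h2 : 0 ≤ -(t * u) := by nlinarith
            nlinarith

/-- Markov's inequality for `(T - u)⁺` at the optimal level `u = x - 1 / t`. -/
theorem measure_le_reflectedWalk_le {X : ℕ → Ω → ℝ} {n : ℕ}
    (hNA : NegativelyAssociated X (Finset.Icc 1 n) μ)
    (hX : ∀ i ∈ Finset.Icc 1 n, Measurable (X i)) {t : ℝ} (ht : 0 < t)
    (hint : ∀ i ∈ Finset.Icc 1 n, Integrable (fun ω => Real.exp (t * X i ω)) μ)
    (hmgf : ∀ i ∈ Finset.Icc 1 n, 1 ≤ mgf (X i) μ t) (x : ℝ) :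
    μ {ω | x ≤ reflectedWalk (fun i => X i ω) 1 n} ≤
      ENNReal.ofReal (Real.exp 1 * ((∏ i ∈ Finset.Icc 1 n, mgf (X i) μ t) *
        Real.exp (-(t * x)))) := by
  have hI : Finset.Icc 1 n = Finset.Ico 1 (1 + n) := by ext i; simp; omega
  have h1 := lintegral_reflectedWalk_sub_le hNA hX ht hint hmgf (k := 1) (j := n) le_rfl
    (by omega) (x - 1 / t)
  rw [← hI] at h1
  have mT : Measurable fun ω => ENNReal.ofReal
      (reflectedWalk (fun i => X i ω) 1 n - (x - 1 / t)) :=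
    ((measurable_reflectedWalk (by rw [← hI]; exact hX)).sub_const _).ennreal_ofReal
  have h2 := mul_meas_ge_le_lintegral mT (ENNReal.ofReal (1 / t)) (μ := μ)
  have h3 : {ω | x ≤ reflectedWalk (fun i => X i ω) 1 n} ⊆ {ω | ENNReal.ofReal (1 / t) ≤
      ENNReal.ofReal (reflectedWalk (fun i => X i ω) 1 n - (x - 1 / t))} := by
    intro ω (hω : x ≤ _)
    exact ENNReal.ofReal_le_ofReal (by linarith)
  have h4 : ENNReal.ofReal (1 / t) * μ {ω | x ≤ reflectedWalk (fun i => X i ω) 1 n} ≤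
      ENNReal.ofReal (1 / t) * ENNReal.ofReal (Real.exp 1 *
        ((∏ i ∈ Finset.Icc 1 n, mgf (X i) μ t) * Real.exp (-(t * x)))) := by
    refine (mul_le_mul_right (measure_mono h3) _).trans (h2.trans (h1.trans (le_of_eq ?_)))
    rw [← ENNReal.ofReal_mul (by positivity)]
    congr 1
    rw [show -(t * (x - 1 / t)) = 1 + -(t * x) by field_simp; ring, Real.exp_add]
    ring
  exact (ENNReal.mul_le_mul_iff_right (by simpa using ht) ENNReal.ofReal_ne_top).1 h4

/-- The exponential moment of a sum of bounded negatively associated variables is at most the product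
of the exponential moments. -/
theorem NegativelyAssociated.mgf_sum_le {ι : Type*} [DecidableEq ι] {X : ι → Ω → ℝ} {s : Finset ι}
    (h : NegativelyAssociated X s μ) (hX : ∀ i ∈ s, Measurable (X i)) {m M : ι → ℝ}
    (hb : ∀ i ∈ s, ∀ᵐ ω ∂μ, m i ≤ X i ω ∧ X i ω ≤ M i) {t : ℝ} (ht : 0 ≤ t) :
    Integrable (fun ω => Real.exp (t * ∑ i ∈ s, X i ω)) μ ∧
      ∫ ω, Real.exp (t * ∑ i ∈ s, X i ω) ∂μ ≤ ∏ i ∈ s, mgf (X i) μ t := by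
  -- square integrability serves both the product in the definition and the covariance formula
  have hI : ∀ A ⊆ s, MemLp (fun ω => Real.exp (t * ∑ i ∈ A, X i ω)) 2 μ := by
    intro A hA
    have mA : Measurable fun ω => ∑ i ∈ A, X i ω := Finset.measurable_sum _ fun i hi => hX i (hA hi)
    have hbA : ∀ᵐ ω ∂μ, ∀ i ∈ A, X i ω ≤ M i :=
      (Finset.eventually_all A).2 fun i hi => (hb i (hA hi)).mono fun ω h => h.2
    refine MemLp.of_bound (mA.const_mul t).exp.aestronglyMeasurable (Real.exp (t * ∑ i ∈ A, M i)) ?_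
    filter_upwards [hbA] with ω hω
    rw [Real.norm_eq_abs, abs_of_pos (Real.exp_pos _)]
    gcongr with i hi
    exact hω i hi
  refine ⟨(hI s le_rfl).integrable (by norm_num), ?_⟩
  suffices H : ∀ A : Finset ι, A ⊆ s →
      ∫ ω, Real.exp (t * ∑ i ∈ A, X i ω) ∂μ ≤ ∏ i ∈ A, mgf (X i) μ t from H s le_rfl
  intro A
  induction A using Finset.induction_on with
  | empty => simp
  | insert k A hk ih =>
    intro hA
    have hks : k ∈ s := hA (Finset.mem_insert_self _ _)
    have hAs : A ⊆ s := (Finset.subset_insert _ _).trans hA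
    have mem1 : MemLp (fun ω => Real.exp (t * X k ω)) 2 μ := by
      simpa using hI {k} (by simpa using hks)
    have i1 := mem1.integrable (by norm_num)
    have mem2 := hI A hAs
    have key := h {k} A (by simpa using hks) hAs (by simpa using hk)
      (fun v => Real.exp (t * v ⟨k, Finset.mem_singleton_self k⟩))
      (fun v => Real.exp (t * ∑ i, v i))
      (fun v w hvw => by dsimp only; gcongr; exact hvw _)
      (fun v w hvw => by dsimp only; gcongr with i; exact hvw i)
      (by fun_prop) (by fun_prop) i1
      (by
        refine (mem2.integrable (by norm_num)).congr (ae_of_all _ fun ω => ?_)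
        simp only
        rw [Finset.sum_coe_sort A fun i => X i ω])
      (by
        refine (mem1.integrable_mul mem2).congr (ae_of_all _ fun ω => ?_)
        simp only [Pi.mul_apply]
        rw [Finset.sum_coe_sort A fun i => X i ω])
    have e : ∀ ω, ∑ i : A, X i ω = ∑ i ∈ A, X i ω := fun ω => Finset.sum_coe_sort A fun i => X i ω
    simp only [e] at key
    rw [covariance_eq_sub mem1 mem2, sub_nonpos] at key
    rw [Finset.prod_insert hk]
    calc ∫ ω, Real.exp (t * ∑ i ∈ insert k A, X i ω) ∂μ
        = ∫ ω, ((fun ω => Real.exp (t * X k ω)) * fun ω => Real.exp (t * ∑ i ∈ A, X i ω)) ω ∂μ := by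
          refine integral_congr_ae (ae_of_all _ fun ω => ?_)
          simp only [Pi.mul_apply]
          rw [Finset.sum_insert hk, mul_add, Real.exp_add]
      _ ≤ mgf (X k) μ t * ∫ ω, Real.exp (t * ∑ i ∈ A, X i ω) ∂μ := key
      _ ≤ _ := mul_le_mul_of_nonneg_left (ih hAs) mgf_nonneg

end NA

end

/-! ### Assembly of the bounds -/

theorem proposition2p9 {Ω : Type*} [MeasurableSpace Ω] (μ : Measure Ω) [IsProbabilityMeasure μ]
    (n : ℕ) (hn : 1 ≤ n) (X : ℕ → Ω → ℝ) (m M : ℕ → ℝ)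
    (hX : ∀ i ∈ Finset.Icc 1 n, Measurable (X i))
    (hNA : NegativelyAssociated X (Finset.Icc 1 n) μ)
    (hmean : ∀ i ∈ Finset.Icc 1 n, ∫ ω, X i ω ∂μ = 0)
    (hbdd : ∀ i ∈ Finset.Icc 1 n, ∀ᵐ ω ∂μ, m i ≤ X i ω ∧ X i ω ≤ M i)
    (hD : 0 < rangeSum m M n) :
    -- the exponential moment bound
    (∀ t : ℝ, 0 ≤ t →
      Integrable (fun ω => Real.exp (t * partialSum X n ω)) μ ∧
      ∫ ω, Real.exp (t * partialSum X n ω) ∂μ ≤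
        Real.exp (rangeSum m M n ^ 2 / rangeSqSum m M n *
          rioEll (rangeSqSum m M n / rangeSum m M n * t))) ∧
    -- the maximal inequality, its explicit form, and the comparison with Hoeffding-Azuma
    (∀ α : ℝ, 0 < α → α < 1 → ∀ x : ℝ, 0 ≤ x → x ≤ rangeSum m M n →
      μ {ω | x ≤ maxPartialSum X n hn ω} ≤
        ENNReal.ofReal (1 - α)⁻¹ *
          EReal.exp (-(((α * rangeSum m M n ^ 2 / rangeSqSum m M n : ℝ) : EReal) *
            rioEllStar (x / rangeSum m M n))) ∧
      μ {ω | x ≤ maxPartialSum X n hn ω} ≤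
        ENNReal.ofReal ((1 - α)⁻¹ *
          ((rangeSum m M n - x) / rangeSum m M n) ^
            ((2 * rangeSum m M n - x) / rangeSqSum m M n * (α * x))) ∧
      ((rangeSum m M n - x) / rangeSum m M n) ^
          ((2 * rangeSum m M n - x) / rangeSqSum m M n * (α * x)) ≤
        Real.exp (-(2 * α * x ^ 2 / rangeSqSum m M n))) ∧
    -- the particular case
    (∀ x : ℝ, 0 ≤ x → x ≤ rangeSum m M n →
      μ {ω | x ≤ maxPartialSum X n hn ω} ≤
        2 * EReal.exp (-(((rangeSum m M n ^ 2 / (2 * rangeSqSum m M n) : ℝ) : EReal) *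
            rioEllStar (x / rangeSum m M n))) ∧
      2 * EReal.exp (-(((rangeSum m M n ^ 2 / (2 * rangeSqSum m M n) : ℝ) : EReal) *
            rioEllStar (x / rangeSum m M n))) ≤
        ENNReal.ofReal (2 *
          ((rangeSum m M n - x) / rangeSum m M n) ^
            ((2 * rangeSum m M n - x) / (2 * rangeSqSum m M n) * x))) := by
  have hdn : ∀ i ∈ Finset.Icc 1 n, 0 ≤ M i - m i := fun i hi => by
    obtain ⟨ω, h⟩ := (hbdd i hi).exists
    linarith [h.1, h.2]
  have hM : 0 < rangeSqSum m M n := by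
    obtain ⟨i, hi, h⟩ := Finset.exists_lt_of_sum_lt (s := Finset.Icc 1 n) (f := fun _ => (0 : ℝ))
      (g := fun i => M i - m i) (by rw [Finset.sum_const_zero]; exact hD)
    exact Finset.sum_pos' (fun _ _ => sq_nonneg _) ⟨i, hi, pow_pos h 2⟩
  set D := rangeSum m M n with hDdef
  set V := rangeSqSum m M n with hVdef
  have hprod : ∀ t : ℝ, 0 ≤ t → ∏ i ∈ Finset.Icc 1 n, mgf (X i) μ t ≤
      Real.exp (D ^ 2 / V * rioEll (V / D * t)) := by
    intro t ht
    calc ∏ i ∈ Finset.Icc 1 n, mgf (X i) μ t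
        ≤ ∏ i ∈ Finset.Icc 1 n, Real.exp (rioEll ((M i - m i) * t)) :=
          Finset.prod_le_prod (fun i _ => mgf_nonneg) fun i hi =>
            mgf_le_exp_rioEll (hX i hi) (hmean i hi) (hbdd i hi) ht
      _ = Real.exp (∑ i ∈ Finset.Icc 1 n, rioEll ((M i - m i) * t)) := (Real.exp_sum _ _).symm
      _ ≤ _ := Real.exp_le_exp.2 (sum_rioEll_le _ _ hdn hD ht)
  have hint : ∀ t : ℝ, ∀ i ∈ Finset.Icc 1 n, Integrable (fun ω => Real.exp (t * X i ω)) μ :=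
    fun t i hi => integrable_exp_mul_of_mem_Icc (hX i hi).aemeasurable (hbdd i hi)
  have hmgf : ∀ t : ℝ, ∀ i ∈ Finset.Icc 1 n, 1 ≤ mgf (X i) μ t := by
    intro t i hi
    have hXi : Integrable (X i) μ :=
      Integrable.of_mem_Icc (m i) (M i) (hX i hi).aemeasurable (hbdd i hi)
    have h1 : ∫ ω, (t * X i ω + 1) ∂μ = 1 := by
      rw [integral_add (by fun_prop) (by fun_prop), integral_const_mul, hmean i hi]
      simp
    rw [← h1]
    exact integral_mono (by fun_prop) (hint t i hi) fun ω => Real.add_one_le_exp _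
  have hMax : ∀ α : ℝ, 0 < α → α < 1 → ∀ x : ℝ,
      μ {ω | x ≤ maxPartialSum X n hn ω} ≤ ENNReal.ofReal (1 - α)⁻¹ *
        EReal.exp (-(((α * D ^ 2 / V : ℝ) : EReal) * rioEllStar (x / D))) := by
    intro α h0 h1 x
    have hα : 0 < 1 - α := by linarith
    refine le_mul_exp_neg_mul_rioEllStar (by positivity) (by positivity) fun s hs => ?_
    -- `s = (V / D) t` is the rescaling that turns the exponent into a Young transform
    set t := D * s / V with ht
    have ht0 : 0 < t := by positivity
    set q := (∏ i ∈ Finset.Icc 1 n, mgf (X i) μ t) * Real.exp (-(t * x)) with hq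
    have hq0 : 0 < q :=
      mul_pos (Finset.prod_pos fun i hi => one_pos.trans_le (hmgf t i hi)) (Real.exp_pos _)
    have hqle : q ≤ Real.exp (-(D ^ 2 / V * (x / D * s - rioEll s))) := by
      have h2 := hprod t ht0.le
      rw [show V / D * t = s by rw [ht]; field_simp] at h2
      calc q ≤ Real.exp (D ^ 2 / V * rioEll s) * Real.exp (-(t * x)) :=
          mul_le_mul_of_nonneg_right h2 (Real.exp_pos _).le
        _ = _ := by
          rw [← Real.exp_add, ht]
          congr 1
          field_simp
          ring
    have htail : μ {ω | x ≤ maxPartialSum X n hn ω} ≤ ENNReal.ofReal (min 1 (Real.exp 1 * q)) := by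
      rw [ENNReal.ofReal_min, ENNReal.ofReal_one]
      refine le_min prob_le_one ((measure_mono fun ω (hω : x ≤ _) => ?_).trans
        (measure_le_reflectedWalk_le hNA hX ht0 (hint t) (hmgf t) x))
      exact hω.trans (maxPartialSum_le_reflectedWalk X hn ω)
    refine htail.trans (ENNReal.ofReal_le_ofReal ((min_one_exp_one_mul_le hq0 h0 h1).trans ?_))
    gcongr
    calc q ^ α ≤ Real.exp (-(D ^ 2 / V * (x / D * s - rioEll s))) ^ α := by gcongr
      _ = _ := by
        rw [← Real.exp_mul]
        congr 1
        ring
  have hExp : ∀ α : ℝ, 0 < α → ∀ x : ℝ, 0 ≤ x → x ≤ D →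
      EReal.exp (-(((α * D ^ 2 / V : ℝ) : EReal) * rioEllStar (x / D))) ≤
        ENNReal.ofReal (((D - x) / D) ^ ((2 * D - x) / V * (α * x))) := by
    intro α h0 x hx0 hxD
    have h := exp_neg_mul_rioEllStar_le (a := α * D ^ 2 / V) (y := x / D) (by positivity)
      (by positivity) ((div_le_one hD).2 hxD)
    rwa [show 1 - x / D = (D - x) / D by field_simp,
      show α * D ^ 2 / V * (2 - x / D) * (x / D) = (2 * D - x) / V * (α * x) by field_simp] at h
  refine ⟨fun t ht => ?_, fun α h0 h1 x hx0 hxD => ⟨hMax α h0 h1 x, ?_, ?_⟩, fun x hx0 hxD => ?_⟩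
  · have h := hNA.mgf_sum_le hX hbdd ht
    exact ⟨h.1, h.2.trans (hprod t ht)⟩
  · have hα : 0 < 1 - α := by linarith
    rw [ENNReal.ofReal_mul (by positivity)]
    exact (hMax α h0 h1 x).trans (by gcongr; exact hExp α h0 x hx0 hxD)
  · have h := one_sub_rpow_le_exp (a := α * D ^ 2 / V) (y := x / D) (by positivity)
      (by positivity) ((div_le_one hD).2 hxD)
    rwa [show 1 - x / D = (D - x) / D by field_simp,
      show α * D ^ 2 / V * (2 - x / D) * (x / D) = (2 * D - x) / V * (α * x) by field_simp,
      show 2 * (α * D ^ 2 / V) * (x / D) ^ 2 = 2 * α * x ^ 2 / V by field_simp] at h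
  · have e1 : D ^ 2 / (2 * V) = 1 / 2 * D ^ 2 / V := by field_simp
    have e2 : (2 * D - x) / (2 * V) * x = (2 * D - x) / V * (1 / 2 * x) := by field_simp
    rw [e1, e2]
    constructor
    · have h := hMax (1 / 2) (by norm_num) (by norm_num) x
      rwa [show ((1 : ℝ) - 1 / 2)⁻¹ = 2 by norm_num,
        show ENNReal.ofReal 2 = 2 by norm_num] at h
    · rw [ENNReal.ofReal_mul two_pos.le, show ENNReal.ofReal 2 = 2 by norm_num]
      gcongr
      exact hExp (1 / 2) (by norm_num) x hx0 hxD
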